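/- Let $\Delta^d$ be the standard $d$-simplex, the convex hull of the $d+1$ unit vectors in $\mathbb{R}^{d+1}$, and let $P=\Delta^1\times\Delta^1\times\Delta^2$, a $4$-dimensional polytope with $12$ vertices. A *simplicial cover* of a $d$-dimensional polytope is a finite collection of (nondegenerate, possibly overlapping) $d$-simplices whose vertices are all vertices of the polytope and whose union is the polytope. A *triangulation* is a collection of $d$-simplices that meet face-to-face and whose union is the polytope. **Theorem.** The minimum number of simplices in a simplicial cover of $P$ is exactly $10$, and this minimum is attained by a triangulation of $P$. Explicitly, write $(a;b;p,q)$ for the point $((1-a,a),(1-b,b),(1-p-q,p,q))$ of $P$, and label the vertices of $P$ as $$v_0=(0;0;0,0),\ v_1=(0;0;0,1),\ v_2=(0;0;1,0),\ v_3=(0;1;0,0),\ v_4=(0;1;0,1),\ v_5=(0;1;1,0),$$ $$v_6=(1;0;0,0),\ v_7=(1;0;0,1),\ v_8=(1;0;1,0),\ v_9=(1;1;0,0),\ v_{10}=(1;1;0,1),\ v_{11}=(1;1;1,0).$$ Then the ten simplices spanned by the vertices with the index sets $$\{0,7,4,9,11\},\ \{0,3,4,9,11\},\ \{0,3,4,5,11\},\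 \{0,2,4,5,11\},\ \{0,2,4,7,11\},$$ $$\{0,2,8,7,11\},\ \{0,6,8,7,11\},\ \{0,6,9,7,11\},\ \{10,7,4,9,11\},\ \{0,2,4,7,1\}$$ are ten distinct simplices that form a simplicial cover of $P$ and a triangulation of $P$. -/

import Mathlib

noncomputable section

/-- The simplotope `Π(c₁, …, cₙ) = Δ^{c₁} × ⋯ × Δ^{cₙ}` in standard coordinates: a point is a
family of vectors, the `i`-th of which lies in the standard simplex of dimension `c i`. -/
def simplotope {n : ℕ} (c : Fin n → ℕ) : Set (∀ i : Fin n, Fin (c i + 1) → ℝ) :=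
  Set.univ.pi fun i => stdSimplex ℝ (Fin (c i + 1))

section Polytope

variable {E : Type*} [AddCommGroup E] [Module ℝ E]

/-- The dimension of (the affine hull of) a set of points. -/
def affineDim (P : Set E) : ℕ := Module.finrank ℝ (vectorSpan ℝ P)

/-- `s` is the vertex set of a (nondegenerate) `d`-simplex. -/
def IsSimplexVertexSet (d : ℕ) (s : Finset E) : Prop :=
  AffineIndependent ℝ ((↑) : s → E) ∧ s.card = d + 1

/-- A simplicial cover of `P`: a finite collection of simplices of the same dimension as `P`, each
given by its vertex set, all of whose vertices are vertices of `P`, and whose union is `P`.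
The simplices may overlap in any way. -/
def IsSimplicialCover (P : Set E) (C : Finset (Finset E)) : Prop :=
  (∀ s ∈ C, IsSimplexVertexSet (affineDim P) s ∧ (s : Set E) ⊆ P.extremePoints ℝ) ∧
    ⋃ s ∈ C, convexHull ℝ (s : Set E) = P

/-- A triangulation of `P`, given by the vertex sets of its top-dimensional simplices: these are
simplices of the same dimension as `P`, and are exactly the maximal faces of a geometric simplicial
complex (so they meet face-to-face) whose underlying space is `P`. -/
def IsTriangulation (P : Set E) (C : Finset (Finset E)) : Prop :=
  (∀ s ∈ C, IsSimplexVertexSet (affineDim P) s) ∧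
    ∃ K : Geometry.SimplicialComplex ℝ E, K.facets = (C : Set (Finset E)) ∧ K.space = P

end Polytope

/-- The point of `Δ¹ × Δ¹ × Δ²` with reduced coordinates `(a; b; p, q)`; its standard coordinates
are `(1 - a, a; 1 - b, b; 1 - p - q, p, q)`. -/
def ofReduced (a b p q : ℝ) : ∀ i : Fin 3, Fin ((![1, 1, 2] : Fin 3 → ℕ) i + 1) → ℝ
  | 0 => (![1 - a, a] : Fin 2 → ℝ)
  | 1 => (![1 - b, b] : Fin 2 → ℝ)
  | 2 => (![1 - p - q, p, q] : Fin 3 → ℝ)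

/-- The twelve vertices of `Δ¹ × Δ¹ × Δ²`, ordered lexicographically by reduced coordinates. -/
def prismVertex :
    Fin 12 → ∀ i : Fin 3, Fin ((![1, 1, 2] : Fin 3 → ℕ) i + 1) → ℝ :=
  ![ofReduced 0 0 0 0, ofReduced 0 0 0 1, ofReduced 0 0 1 0,
    ofReduced 0 1 0 0, ofReduced 0 1 0 1, ofReduced 0 1 1 0,
    ofReduced 1 0 0 0, ofReduced 1 0 0 1, ofReduced 1 0 1 0,
    ofReduced 1 1 0 0, ofReduced 1 1 0 1, ofReduced 1 1 1 0]

/-- The labels of the vertices of ten explicit simplices. -/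
def tenLabels : Finset (Finset (Fin 12)) :=
  {{0, 7, 4, 9, 11}, {0, 3, 4, 9, 11}, {0, 3, 4, 5, 11}, {0, 2, 4, 5, 11}, {0, 2, 4, 7, 11},
    {0, 2, 8, 7, 11}, {0, 6, 8, 7, 11}, {0, 6, 9, 7, 11}, {10, 7, 4, 9, 11}, {0, 2, 4, 7, 1}}

/-- The ten explicit simplices, as sets of vertices of `Δ¹ × Δ¹ × Δ²`. -/
def tenSimplices :
    Finset (Finset (∀ i : Fin 3, Fin ((![1, 1, 2] : Fin 3 → ℕ) i + 1) → ℝ)) :=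
  tenLabels.image fun s => s.image prismVertex

end

/-! Lower bound: twenty points of the prism are chosen so that no simplex on five vertices contains
more than two of them; a cover then needs at least 20 / 2 = 10 simplices. The points form two
orbits, of sizes 8 and 12, of the symmetry group of the prism. To bound how many of them a simplex
contains, a fixed list of affine forms is used: a form that is nonnegative on the five vertices is
nonnegative on their hull, so a point where it is negative is excluded. That at most two points
survive is a finite check over all 5-subsets of the vertices (`countP_testRow_le`).

Upper bound: each of the ten simplices has five integral facet forms dual to its vertices, hence is
nondegenerate and is cut out of the prism by the inequalities that these forms are nonnegative. Nine
hyperplanes, arranged as a binary decision tree with ten leaves, distribute the points of the prism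
among the simplices (`exists_forall_tenFacet_nonneg`). The same nine hyperplanes separate the
simplices pairwise in such a way that any two meet in the hull of their common vertices, which makes
the cover a triangulation. -/

/-! ### Integer certificate for the lower bound -/

/-- The value of an integral form on an integral vector of homogeneous reduced coordinates. -/
def intForm (n v : Fin 5 → ℤ) : ℤ :=
  n 0 * v 0 + n 1 * v 1 + n 2 * v 2 + n 3 * v 3 + n 4 * v 4

/-- Homogeneous reduced coordinates `(1, a, b, p, q)` of the twelve vertices. -/
def vertexRow : Fin 12 → Fin 5 → ℤ :=
  ![![1, 0, 0, 0, 0], ![1, 0, 0, 0, 1], ![1, 0, 0, 1, 0],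
    ![1, 0, 1, 0, 0], ![1, 0, 1, 0, 1], ![1, 0, 1, 1, 0],
    ![1, 1, 0, 0, 0], ![1, 1, 0, 0, 1], ![1, 1, 0, 1, 0],
    ![1, 1, 1, 0, 0], ![1, 1, 1, 0, 1], ![1, 1, 1, 1, 0]]

/-- Homogeneous reduced coordinates of twenty points of the prism, no three of which lie in a
common simplex spanned by vertices. -/
def testRow : Fin 20 → Fin 5 → ℤ :=
  ![![30, 3, 6, 10, 10], ![30, 3, 24, 10, 10], ![30, 27, 6, 10, 10], ![30, 27, 24, 10, 10],
    ![30, 6, 3, 10, 10], ![30, 6, 27, 10, 10], ![30, 24, 3, 10, 10], ![30, 24, 27, 10, 10],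
    ![22, 11, 6, 4, 4], ![22, 11, 6, 4, 14], ![22, 11, 6, 14, 4],
    ![22, 11, 16, 4, 4], ![22, 11, 16, 4, 14], ![22, 11, 16, 14, 4],
    ![22, 6, 11, 4, 4], ![22, 6, 11, 4, 14], ![22, 6, 11, 14, 4],
    ![22, 16, 11, 4, 4], ![22, 16, 11, 4, 14], ![22, 16, 11, 14, 4]]

/-- Forms cutting out the half-spaces that separate the test points from the simplices. -/
def testForms : List (Fin 5 → ℤ) :=
  let us : List (Fin 5 → ℤ) := [![0, 1, 0, 0, 0], ![1, -1, 0, 0, 0]]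
  let vs : List (Fin 5 → ℤ) := [![0, 0, 1, 0, 0], ![1, 0, -1, 0, 0]]
  let ts : List (Fin 5 → ℤ) := [![1, 0, 0, -1, -1], ![0, 0, 0, 1, 0], ![0, 0, 0, 0, 1]]
  let e : Fin 5 → ℤ := ![1, 0, 0, 0, 0]
  ((us ++ vs).flatMap fun s => ts.map fun t => s + t - e) ++
    us.flatMap fun u => vs.flatMap fun v =>
      (u + v - e) :: ts.flatMap fun t => [u + v + t - e, u + v + t - e - e, u + v - t]

/-- The set of members of a list that satisfy `f`, as a bit mask. -/
def bitMask {α : Type*} (f : α → Bool) : List α → ℕ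
  | [] => 0
  | n :: L => Nat.bit (f n) (bitMask f L)

/-- Masks turn conjunctions over the whole list of forms into one bitwise operation on numerals,
which keeps the kernel check below feasible. -/
lemma bitMask_land {α : Type*} (f g : α → Bool) (L : List α) :
    bitMask f L &&& bitMask g L = bitMask (fun n => f n && g n) L := by
  induction L with
  | nil => simp [bitMask]
  | cons n L ih => simp only [bitMask, Nat.land_bit, ih]

lemma bitMask_congr {α : Type*} {f g : α → Bool} {L : List α} (h : ∀ n ∈ L, f n = g n) :
    bitMask f L = bitMask g L := by
  induction L with
  | nil => rfl
  | cons n L ih =>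
    simp only [bitMask, h n (by simp), ih fun m hm => h m (by simp [hm])]

/-- The mask of the test forms that are nonnegative on a vector. -/
def nonnegMask (v : Fin 5 → ℤ) : ℕ := bitMask (fun n => decide (0 ≤ intForm n v)) testForms

/-- The mask of the test forms that are nonnegative on all listed vertices. -/
def commonMask (l : List (Fin 12)) : ℕ :=
  l.foldr (fun i m => nonnegMask (vertexRow i) &&& m) (bitMask (fun _ => true) testForms)

lemma commonMask_eq (l : List (Fin 12)) :
    commonMask l =
      bitMask (fun n => l.all fun i => decide (0 ≤ intForm n (vertexRow i))) testForms := by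
  induction l with
  | nil => rfl
  | cons i l ih =>
    change nonnegMask _ &&& commonMask l = _
    rw [ih, nonnegMask, bitMask_land]
    rfl

/-- The equation `m &&& m' == m` tests inclusion of masks: every form that is nonnegative on the
five vertices is nonnegative on the test point. Degenerate 5-subsets are checked too. -/
lemma countP_testRow_le : ∀ l ∈ List.sublistsLen 5 (List.finRange 12),
    ((List.finRange 20).countP fun j =>
      commonMask l &&& nonnegMask (testRow j) == commonMask l) ≤ 2 := by
  decide +kernel

/-- At most two test points cannot be separated by a test form from five given vertices. -/
lemma card_filter_testRow_le (t : Finset (Fin 12)) (ht : t.card = 5) (J : Finset (Fin 20))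
    (hJ : ∀ j ∈ J, ∀ n ∈ testForms, (∀ i ∈ t, 0 ≤ intForm n (vertexRow i)) →
      0 ≤ intForm n (testRow j)) : J.card ≤ 2 := by
  -- Listing `t` in increasing order makes it one of the enumerated sublists.
  set l := (List.finRange 12).filter (· ∈ t) with hl
  have hmem : ∀ i, i ∈ l ↔ i ∈ t := by simp [hl]
  have hnd : l.Nodup := (List.nodup_finRange 12).filter _
  have hlen : l.length = 5 := by
    rw [← ht, ← List.toFinset_card_of_nodup hnd]
    congr 1
    ext i
    simp [hmem]
  have hc := countP_testRow_le l (List.mem_sublistsLen.2 ⟨List.filter_sublist, hlen⟩)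
  refine le_trans ?_ hc
  rw [List.countP_eq_length_filter,
    ← List.toFinset_card_of_nodup ((List.nodup_finRange 20).filter _)]
  refine Finset.card_le_card fun j hj => ?_
  simp only [List.mem_toFinset, List.mem_filter, List.mem_finRange, true_and, beq_iff_eq]
  rw [commonMask_eq, nonnegMask, bitMask_land]
  refine bitMask_congr fun n hn => ?_
  by_cases h : ∀ i ∈ l, 0 ≤ intForm n (vertexRow i)
  · have := hJ j hj n hn fun i hi => h i ((hmem i).2 hi)
    simp [this]
  · have : (l.all fun i => decide (0 ≤ intForm n (vertexRow i))) = false := by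
      simpa using h
    simp only [this, Bool.false_and]

noncomputable section

/-! ### Reduced coordinates and linear forms on the prism -/

/-- The ambient space of `Δ¹ × Δ¹ × Δ²`. -/
abbrev PrismSpace : Type := ∀ i : Fin 3, Fin ((![1, 1, 2] : Fin 3 → ℕ) i + 1) → ℝ

/-- The first factor of a point. -/
def blockA : PrismSpace →ₗ[ℝ] (Fin 2 → ℝ) := LinearMap.proj 0

/-- The second factor of a point. -/
def blockB : PrismSpace →ₗ[ℝ] (Fin 2 → ℝ) := LinearMap.proj 1

/-- The third factor of a point. -/
def blockC : PrismSpace →ₗ[ℝ] (Fin 3 → ℝ) := LinearMap.proj 2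

lemma blockA_ofReduced (a b p q : ℝ) : blockA (ofReduced a b p q) = ![1 - a, a] := rfl

lemma blockB_ofReduced (a b p q : ℝ) : blockB (ofReduced a b p q) = ![1 - b, b] := rfl

lemma blockC_ofReduced (a b p q : ℝ) : blockC (ofReduced a b p q) = ![1 - p - q, p, q] := rfl

lemma PrismSpace.ext_blocks {x y : PrismSpace} (hA : blockA x = blockA y)
    (hB : blockB x = blockB y) (hC : blockC x = blockC y) : x = y := by
  funext i
  fin_cases i
  exacts [hA, hB, hC]

/-- The linear form with value `n 0 + n 1 * a + n 2 * b + n 3 * p + n 4 * q` at the point with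
reduced coordinates `(a; b; p, q)`. -/
def prismForm (n : Fin 5 → ℤ) : PrismSpace →ₗ[ℝ] ℝ where
  -- The constant term is homogenized by the coordinate sum of the first factor, which is 1 on the
  -- prism.
  toFun x := n 0 * (blockA x 0 + blockA x 1) + n 1 * blockA x 1 +
    n 2 * blockB x 1 + n 3 * blockC x 1 + n 4 * blockC x 2
  map_add' x y := by simp only [map_add, Pi.add_apply]; ring
  map_smul' c x := by simp only [map_smul, Pi.smul_apply, smul_eq_mul, RingHom.id_apply]; ring

lemma prismForm_ofReduced (n : Fin 5 → ℤ) (a b p q : ℝ) :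
    prismForm n (ofReduced a b p q) = n 0 + n 1 * a + n 2 * b + n 3 * p + n 4 * q := by
  simp [prismForm, blockA_ofReduced, blockB_ofReduced, blockC_ofReduced]

lemma prismVertex_eq (i : Fin 12) : prismVertex i =
    ofReduced (vertexRow i 1) (vertexRow i 2) (vertexRow i 3) (vertexRow i 4) := by
  fin_cases i <;> simp [prismVertex, vertexRow]

lemma prismForm_prismVertex (n : Fin 5 → ℤ) (i : Fin 12) :
    prismForm n (prismVertex i) = intForm n (vertexRow i) := by
  have h : vertexRow i 0 = 1 := by fin_cases i <;> rfl
  rw [prismVertex_eq, prismForm_ofReduced, intForm, h]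
  push_cast
  ring

lemma mem_pi_blocks {A B : Set (Fin 2 → ℝ)} {C : Set (Fin 3 → ℝ)}
    {S : ∀ i : Fin 3, Set (Fin ((![1, 1, 2] : Fin 3 → ℕ) i + 1) → ℝ)}
    (hA : S 0 = A) (hB : S 1 = B) (hC : S 2 = C) {x : PrismSpace} :
    x ∈ Set.univ.pi S ↔ blockA x ∈ A ∧ blockB x ∈ B ∧ blockC x ∈ C := by
  rw [Set.mem_univ_pi, ← hA, ← hB, ← hC]
  exact ⟨fun h => ⟨h 0, h 1, h 2⟩, fun h i => by
    fin_cases i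
    exacts [h.1, h.2.1, h.2.2]⟩

lemma mem_simplotope_iff {x : PrismSpace} : x ∈ simplotope ![1, 1, 2] ↔
    blockA x ∈ stdSimplex ℝ (Fin 2) ∧ blockB x ∈ stdSimplex ℝ (Fin 2) ∧
      blockC x ∈ stdSimplex ℝ (Fin 3) :=
  mem_pi_blocks rfl rfl rfl

lemma ofReduced_mem_simplotope {a b p q : ℝ} : ofReduced a b p q ∈ simplotope ![1, 1, 2] ↔
    (0 ≤ a ∧ a ≤ 1) ∧ (0 ≤ b ∧ b ≤ 1) ∧ 0 ≤ p ∧ 0 ≤ q ∧ p + q ≤ 1 := by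
  have h (u : ℝ) : ![1 - u, u] ∈ stdSimplex ℝ (Fin 2) ↔ 0 ≤ u ∧ u ≤ 1 := by
    simp [stdSimplex, Fin.forall_fin_two, and_comm]
  have h' : ![1 - p - q, p, q] ∈ stdSimplex ℝ (Fin 3) ↔ 0 ≤ p ∧ 0 ≤ q ∧ p + q ≤ 1 := by
    simp only [stdSimplex, Set.mem_ofPred_eq, Fin.forall_fin_succ, Fin.sum_univ_three]
    simp
    constructor
    · rintro ⟨⟨h, hp, hq⟩, -⟩
      exact ⟨hp, hq, by linarith⟩
    · rintro ⟨hp, hq, h⟩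
      exact ⟨⟨by linarith, hp, hq⟩, by ring⟩
  rw [mem_simplotope_iff, blockA_ofReduced, blockB_ofReduced, blockC_ofReduced, h, h, h']

lemma eq_ofReduced_of_mem_simplotope {x : PrismSpace} (hx : x ∈ simplotope ![1, 1, 2]) :
    x = ofReduced (blockA x 1) (blockB x 1) (blockC x 1) (blockC x 2) := by
  obtain ⟨⟨-, hA⟩, ⟨-, hB⟩, ⟨-, hC⟩⟩ := mem_simplotope_iff.1 hx
  rw [Fin.sum_univ_two] at hA hB
  rw [Fin.sum_univ_three] at hC
  refine PrismSpace.ext_blocks ?_ ?_ ?_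
  · rw [blockA_ofReduced, ← hA]
    ext j; fin_cases j <;> simp
  · rw [blockB_ofReduced, ← hB]
    ext j; fin_cases j <;> simp
  · rw [blockC_ofReduced, ← hC]
    ext j; fin_cases j <;> simp
    ring

lemma prismVertex_injective : Function.Injective prismVertex := by
  have h : Function.Injective fun i k => intForm (Pi.single k 1) (vertexRow i) := by
    decide +kernel
  intro i j hij
  refine h (funext fun k => ?_)
  have := congrArg (prismForm (Pi.single k 1)) hij
  rw [prismForm_prismVertex, prismForm_prismVertex] at this
  exact_mod_cast this

/-! ### Vertices and dimension of the prism -/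

lemma extremePoints_stdSimplex (ι : Type*) [Fintype ι] [DecidableEq ι] :
    (stdSimplex ℝ ι).extremePoints ℝ = Set.range fun i : ι => (Pi.single i 1 : ι → ℝ) := by
  refine Set.Subset.antisymm ?_ ?_
  · rw [← convexHull_rangle_single_eq_stdSimplex]
    exact extremePoints_convexHull_subset
  · rintro _ ⟨i, rfl⟩
    rw [mem_extremePoints_iff_left]
    refine ⟨single_mem_stdSimplex ℝ i, ?_⟩
    rintro y hy z hz ⟨s, t, hs, ht, -, hst⟩
    -- A positive combination of nonnegative numbers vanishes only if each of them does.
    have hyj : ∀ j, j ≠ i → y j = 0 := fun j hj => by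
      have := congrFun hst j
      simp only [Pi.add_apply, Pi.smul_apply, smul_eq_mul, Pi.single_eq_of_ne hj] at this
      have h1 := mul_nonneg hs.le (hy.1 j)
      have h2 := mul_nonneg ht.le (hz.1 j)
      have h3 : s * y j = 0 := by linarith
      exact (mul_eq_zero.1 h3).resolve_left hs.ne'
    have hyi : y i = 1 := by
      rw [← hy.2]
      exact (Finset.sum_eq_single i (fun j _ hj => hyj j hj) (by simp)).symm
    funext j
    by_cases hj : j = i
    · subst hj; simp [hyi]
    · simp [hyj j hj, hj]

lemma mem_extremePoints_simplotope_iff {x : PrismSpace} :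
    x ∈ (simplotope ![1, 1, 2]).extremePoints ℝ ↔
      blockA x ∈ (Set.range fun k : Fin 2 => (Pi.single k 1 : Fin 2 → ℝ)) ∧
      blockB x ∈ (Set.range fun k : Fin 2 => (Pi.single k 1 : Fin 2 → ℝ)) ∧
      blockC x ∈ (Set.range fun k : Fin 3 => (Pi.single k 1 : Fin 3 → ℝ)) := by
  rw [simplotope, extremePoints_pi]
  exact mem_pi_blocks (extremePoints_stdSimplex (Fin 2)) (extremePoints_stdSimplex (Fin 2))
    (extremePoints_stdSimplex (Fin 3))

lemma extremePoints_simplotope :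
    (simplotope ![1, 1, 2]).extremePoints ℝ = Set.range prismVertex := by
  ext x
  constructor
  · intro hx
    obtain ⟨⟨i, hi⟩, ⟨j, hj⟩, ⟨k, hk⟩⟩ := mem_extremePoints_simplotope_iff.1 hx
    rw [eq_ofReduced_of_mem_simplotope (extremePoints_subset hx), ← hi, ← hj, ← hk]
    -- The labels 1 and 2 are swapped because the lexicographic order puts `(p, q) = (0, 1)` before
    -- `(1, 0)`.
    refine ⟨![![![0, 2, 1], ![3, 5, 4]], ![![6, 8, 7], ![9, 11, 10]]] i j k, ?_⟩
    fin_cases i <;> fin_cases j <;> fin_cases k <;> simp [prismVertex]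
  · rintro ⟨m, rfl⟩
    have h2 (u : ℝ) (hu : u = 0 ∨ u = 1) :
        ![1 - u, u] ∈ Set.range fun k : Fin 2 => (Pi.single k 1 : Fin 2 → ℝ) := by
      obtain rfl | rfl := hu
      · exact ⟨0, by ext j; fin_cases j <;> simp⟩
      · exact ⟨1, by ext j; fin_cases j <;> simp⟩
    have h3 (p q : ℝ) (hpq : p = 0 ∧ q = 0 ∨ p = 1 ∧ q = 0 ∨ p = 0 ∧ q = 1) :
        ![1 - p - q, p, q] ∈ Set.range fun k : Fin 3 => (Pi.single k 1 : Fin 3 → ℝ) := by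
      obtain ⟨rfl, rfl⟩ | ⟨rfl, rfl⟩ | ⟨rfl, rfl⟩ := hpq
      · exact ⟨0, by ext j; fin_cases j <;> simp⟩
      · exact ⟨1, by ext j; fin_cases j <;> simp⟩
      · exact ⟨2, by ext j; fin_cases j <;> simp⟩
    rw [mem_extremePoints_simplotope_iff, prismVertex_eq, blockA_ofReduced, blockB_ofReduced,
      blockC_ofReduced]
    refine ⟨h2 _ ?_, h2 _ ?_, h3 _ _ ?_⟩ <;> fin_cases m <;> simp [vertexRow]

/-- The linear map sending increments of reduced coordinates to displacements. -/
def reducedDirection : (Fin 4 → ℝ) →ₗ[ℝ] PrismSpace where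
  toFun d := ofReduced (d 0) (d 1) (d 2) (d 3) - ofReduced 0 0 0 0
  map_add' d e := by
    refine PrismSpace.ext_blocks ?_ ?_ ?_ <;>
      simp only [map_add, map_sub, blockA_ofReduced, blockB_ofReduced, blockC_ofReduced] <;>
      ext j <;> fin_cases j <;> simp <;> ring
  map_smul' c d := by
    refine PrismSpace.ext_blocks ?_ ?_ ?_ <;>
      simp only [map_smul, map_sub, blockA_ofReduced, blockB_ofReduced, blockC_ofReduced] <;>
      ext j <;> fin_cases j <;> (simp; try ring)

lemma reducedDirection_sub (d e : Fin 4 → ℝ) : reducedDirection (d - e) =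
    ofReduced (d 0) (d 1) (d 2) (d 3) - ofReduced (e 0) (e 1) (e 2) (e 3) := by
  rw [map_sub]
  simp [reducedDirection]

lemma reducedDirection_injective : Function.Injective reducedDirection := by
  rw [injective_iff_map_eq_zero]
  intro d hd
  have h : ofReduced (d 0) (d 1) (d 2) (d 3) = ofReduced 0 0 0 0 := sub_eq_zero.1 hd
  have hA := congrArg (fun x => blockA x 1) h
  have hB := congrArg (fun x => blockB x 1) h
  have hC := congrArg (fun x => blockC x 1) h
  have hD := congrArg (fun x => blockC x 2) h
  simp only [blockA_ofReduced, blockB_ofReduced, blockC_ofReduced] at hA hB hC hD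
  ext j
  fin_cases j
  exacts [hA, hB, hC, hD]

lemma vectorSpan_simplotope :
    vectorSpan ℝ (simplotope ![1, 1, 2]) = LinearMap.range reducedDirection := by
  apply le_antisymm
  · rw [vectorSpan, Submodule.span_le]
    rintro _ ⟨x, hx, y, hy, rfl⟩
    refine ⟨![blockA x 1, blockB x 1, blockC x 1, blockC x 2] -
      ![blockA y 1, blockB y 1, blockC y 1, blockC y 2], ?_⟩
    rw [reducedDirection_sub]
    change ofReduced (blockA x 1) (blockB x 1) (blockC x 1) (blockC x 2) -
      ofReduced (blockA y 1) (blockB y 1) (blockC y 1) (blockC y 2) = x - y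
    rw [← eq_ofReduced_of_mem_simplotope hx, ← eq_ofReduced_of_mem_simplotope hy]
  · rw [LinearMap.range_eq_map, ← (Pi.basisFun ℝ (Fin 4)).span_eq, Submodule.map_span,
      Submodule.span_le]
    rintro _ ⟨_, ⟨k, rfl⟩, rfl⟩
    refine vsub_mem_vectorSpan ℝ ?_ (ofReduced_mem_simplotope.2 (by norm_num))
    fin_cases k <;> exact ofReduced_mem_simplotope.2 (by simp)

lemma affineDim_simplotope : affineDim (simplotope ![1, 1, 2]) = 4 := by
  rw [affineDim, vectorSpan_simplotope, LinearMap.finrank_range_of_inj reducedDirection_injective]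
  simp

/-! ### Counting test points in a cover -/

/-- The point with integral homogeneous reduced coordinates `v`. -/
def rowPoint (v : Fin 5 → ℤ) : PrismSpace :=
  ofReduced (v 1 / v 0) (v 2 / v 0) (v 3 / v 0) (v 4 / v 0)

lemma rowPoint_mem_simplotope {v : Fin 5 → ℤ} (hv : 0 < v 0) (ha : 0 ≤ v 1 ∧ v 1 ≤ v 0)
    (hb : 0 ≤ v 2 ∧ v 2 ≤ v 0) (hpq : 0 ≤ v 3 ∧ 0 ≤ v 4 ∧ v 3 + v 4 ≤ v 0) :
    rowPoint v ∈ simplotope ![1, 1, 2] := by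
  have hv' : (0 : ℝ) < v 0 := by exact_mod_cast hv
  rw [rowPoint, ofReduced_mem_simplotope, ← add_div]
  simp only [div_le_one hv', le_div_iff₀ hv', zero_mul]
  have := And.intro ha (And.intro hb hpq)
  exact_mod_cast this

lemma rowPoint_testRow_mem (j : Fin 20) : rowPoint (testRow j) ∈ simplotope ![1, 1, 2] := by
  have h : ∀ j, 0 < testRow j 0 ∧ (0 ≤ testRow j 1 ∧ testRow j 1 ≤ testRow j 0) ∧
      (0 ≤ testRow j 2 ∧ testRow j 2 ≤ testRow j 0) ∧
      0 ≤ testRow j 3 ∧ 0 ≤ testRow j 4 ∧ testRow j 3 + testRow j 4 ≤ testRow j 0 := by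
    decide +kernel
  obtain ⟨hv, ha, hb, hpq⟩ := h j
  exact rowPoint_mem_simplotope hv ha hb hpq

lemma intForm_nonneg_of_prismForm_nonneg {n v : Fin 5 → ℤ} (hv : 0 < v 0)
    (h : 0 ≤ prismForm n (rowPoint v)) : 0 ≤ intForm n v := by
  have hv' : (0 : ℝ) < v 0 := by exact_mod_cast hv
  have : (intForm n v : ℝ) = prismForm n (rowPoint v) * v 0 := by
    rw [rowPoint, prismForm_ofReduced, intForm]
    push_cast
    field_simp
  have h' : (0 : ℝ) ≤ intForm n v := this ▸ mul_nonneg h hv'.le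
  exact_mod_cast h'

lemma linearMap_nonneg_of_mem_convexHull {E : Type*} [AddCommGroup E] [Module ℝ E]
    (f : E →ₗ[ℝ] ℝ) {s : Set E} (hs : ∀ v ∈ s, 0 ≤ f v) {x : E} (hx : x ∈ convexHull ℝ s) :
    0 ≤ f x :=
  convexHull_min hs (convex_halfSpace_ge f.isLinear 0) hx

lemma ten_le_card_of_isSimplicialCover {C : Finset (Finset PrismSpace)}
    (hC : IsSimplicialCover (simplotope ![1, 1, 2]) C) : 10 ≤ C.card := by
  classical
  obtain ⟨hC, hU⟩ := hC
  let J (s : Finset PrismSpace) : Finset (Fin 20) :=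
    Finset.univ.filter fun j => rowPoint (testRow j) ∈ convexHull ℝ (s : Set PrismSpace)
  have hJ : ∀ s ∈ C, (J s).card ≤ 2 := by
    intro s hs
    obtain ⟨⟨-, hcard⟩, hext⟩ := hC s hs
    rw [affineDim_simplotope] at hcard
    rw [extremePoints_simplotope] at hext
    -- Passing from a simplex to the labels of its vertices loses nothing, so the label set again
    -- has five elements.
    have him : (Finset.univ.filter fun i => prismVertex i ∈ s).image prismVertex = s := by
      ext x
      simp only [Finset.mem_image, Finset.mem_filter, Finset.mem_univ, true_and]
      constructor
      · rintro ⟨i, hi, rfl⟩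
        exact hi
      · intro hx
        obtain ⟨i, rfl⟩ := hext hx
        exact ⟨i, hx, rfl⟩
    refine card_filter_testRow_le (Finset.univ.filter fun i => prismVertex i ∈ s) ?_ _ ?_
    · rw [← Finset.card_image_of_injective _ prismVertex_injective, him, hcard]
    · intro j hj n _ hn
      have hpos : ∀ j, 0 < testRow j 0 := by decide
      refine intForm_nonneg_of_prismForm_nonneg (hpos j)
        (linearMap_nonneg_of_mem_convexHull (prismForm n) ?_ (Finset.mem_filter.1 hj).2)
      intro v hv
      obtain ⟨i, rfl⟩ := hext hv
      rw [prismForm_prismVertex]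
      exact_mod_cast hn i (by simpa using hv)
  have hcover : (Finset.univ : Finset (Fin 20)) ⊆ C.biUnion J := by
    intro j _
    have := rowPoint_testRow_mem j
    rw [← hU, Set.mem_iUnion₂] at this
    obtain ⟨s, hs, hj⟩ := this
    exact Finset.mem_biUnion.2 ⟨s, hs, Finset.mem_filter.2 ⟨Finset.mem_univ j, hj⟩⟩
  have := (Finset.card_le_card hcover).trans (Finset.card_biUnion_le_card_mul C J 2 hJ)
  rw [Finset.card_univ, Fintype.card_fin] at this
  omega

/-! ### The ten simplices cover the prism -/

/-- The vertices of the ten simplices, in a fixed order. -/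
def tenVertex : Fin 10 → Fin 5 → Fin 12 :=
  ![![0, 7, 4, 9, 11],
    ![0, 3, 4, 9, 11],
    ![0, 3, 4, 5, 11],
    ![0, 2, 4, 5, 11],
    ![0, 2, 4, 7, 11],
    ![0, 2, 8, 7, 11],
    ![0, 6, 8, 7, 11],
    ![0, 6, 9, 7, 11],
    ![10, 7, 4, 9, 11],
    ![0, 2, 4, 7, 1]]

/-- The facet forms of the ten simplices: the `k`-th one vanishes on all vertices but the
`k`-th. -/
def tenFacet : Fin 10 → Fin 5 → Fin 5 → ℤ :=
  ![![![2, -1, -1, 0, -1], ![0, 1, -1, 0, 1], ![0, -1, 1, 0, 1], ![0, 1, 1, -2, -1],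
      ![0, 0, 0, 2, 0]],
    ![![1, 0, -1, 0, 0], ![0, -1, 1, 0, -1], ![0, 0, 0, 0, 1], ![0, 1, 0, -1, 0],
      ![0, 0, 0, 1, 0]],
    ![![1, 0, -1, 0, 0], ![0, 0, 1, -1, -1], ![0, 0, 0, 0, 1], ![0, -1, 0, 1, 0],
      ![0, 1, 0, 0, 0]],
    ![![1, 0, 0, -1, -1], ![0, 0, -1, 1, 1], ![0, 0, 0, 0, 1], ![0, -1, 1, 0, -1],
      ![0, 1, 0, 0, 0]],
    ![![2, 0, 0, -2, -2], ![0, -1, -1, 2, 1], ![0, -1, 1, 0, 1], ![0, 1, -1, 0, 1],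
      ![0, 1, 1, 0, -1]],
    ![![1, 0, 0, -1, -1], ![0, -1, 0, 1, 1], ![0, 1, -1, 0, -1], ![0, 0, 0, 0, 1],
      ![0, 0, 1, 0, 0]],
    ![![1, -1, 0, 0, 0], ![0, 1, 0, -1, -1], ![0, 0, -1, 1, 0], ![0, 0, 0, 0, 1],
      ![0, 0, 1, 0, 0]],
    ![![1, -1, 0, 0, 0], ![0, 1, -1, 0, -1], ![0, 0, 1, -1, 0], ![0, 0, 0, 0, 1],
      ![0, 0, 0, 1, 0]],
    ![![-2, 1, 1, 0, 1], ![1, 0, -1, 0, 0], ![1, -1, 0, 0, 0], ![1, 0, 0, -1, -1],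
      ![0, 0, 0, 1, 0]],
    ![![1, 0, 0, -1, -1], ![0, 0, 0, 1, 0], ![0, 0, 1, 0, 0], ![0, 1, 0, 0, 0],
      ![0, -1, -1, 0, 1]]]

/-- The normalized volumes of the ten simplices. -/
def tenVolume : Fin 10 → ℤ := ![2, 1, 1, 1, 2, 1, 1, 1, 1, 1]

lemma tenVolume_pos (i : Fin 10) : (0 : ℝ) < tenVolume i := by
  have h : ∀ i, 0 < tenVolume i := by decide
  exact_mod_cast h i

lemma intForm_tenFacet (i : Fin 10) (j k : Fin 5) :
    intForm (tenFacet i j) (vertexRow (tenVertex i k)) = if k = j then tenVolume i else 0 := by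
  revert i j k
  decide +kernel

/-- The matrices of facet forms and of vertices are inverse up to the volume. This is the product in
the other order: it recovers a point from its facet values, while `intForm_tenFacet` isolates a
single weight. -/
lemma sum_tenFacet_mul_vertexRow (i : Fin 10) (l m : Fin 5) :
    ∑ k, tenFacet i k l * vertexRow (tenVertex i k) m = if l = m then tenVolume i else 0 := by
  revert i l m
  decide +kernel

/-- The vertex set of the `i`-th of the ten simplices. -/
def tenSimplex (i : Fin 10) : Finset PrismSpace :=
  Finset.univ.image fun k => prismVertex (tenVertex i k)

lemma coe_tenSimplex (i : Fin 10) :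
    (tenSimplex i : Set PrismSpace) = Set.range fun k => prismVertex (tenVertex i k) := by
  simp [tenSimplex]

lemma tenSimplices_eq : tenSimplices = Finset.univ.image tenSimplex := by
  have h : tenLabels = Finset.univ.image fun i => Finset.univ.image (tenVertex i) := by
    decide +kernel
  rw [tenSimplices, h, Finset.image_image]
  refine Finset.image_congr fun i _ => ?_
  change Finset.image prismVertex (Finset.univ.image (tenVertex i)) = _
  rw [Finset.image_image]
  rfl

lemma card_tenSimplices : tenSimplices.card = 10 := by
  rw [tenSimplices, Finset.card_image_of_injective _
    (Finset.image_injective prismVertex_injective)]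
  decide +kernel

lemma affineIndependent_tenVertex (i : Fin 10) :
    AffineIndependent ℝ fun k => prismVertex (tenVertex i k) := by
  rw [affineIndependent_iff]
  intro s w _ hw j hj
  -- The `j`-th facet form annihilates every vertex but the `j`-th, so only the weight `w j`
  -- survives.
  have h := congrArg (prismForm (tenFacet i j)) hw
  simp only [map_sum, map_smul, prismForm_prismVertex, intForm_tenFacet, map_zero, smul_eq_mul,
    Int.cast_ite, Int.cast_zero, mul_ite, mul_zero, Finset.sum_ite_eq', hj, if_true] at h
  exact (mul_eq_zero.1 h).resolve_right (tenVolume_pos i).ne'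

lemma isSimplexVertexSet_tenSimplex (i : Fin 10) : IsSimplexVertexSet 4 (tenSimplex i) := by
  constructor
  · have h := (affineIndependent_tenVertex i).range
    rw [← coe_tenSimplex] at h
    exact h
  · rw [tenSimplex, Finset.card_image_of_injective _ (affineIndependent_tenVertex i).injective]
    rfl

lemma tenSimplex_subset_extremePoints (i : Fin 10) :
    (tenSimplex i : Set PrismSpace) ⊆ (simplotope ![1, 1, 2]).extremePoints ℝ := by
  rw [coe_tenSimplex, extremePoints_simplotope]
  rintro _ ⟨k, rfl⟩
  exact ⟨_, rfl⟩

lemma convex_simplotope {n : ℕ} (c : Fin n → ℕ) : Convex ℝ (simplotope c) :=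
  convex_pi fun _ _ => convex_stdSimplex ℝ _

lemma convexHull_tenSimplex_subset (i : Fin 10) :
    convexHull ℝ (tenSimplex i : Set PrismSpace) ⊆ simplotope ![1, 1, 2] :=
  convexHull_min ((tenSimplex_subset_extremePoints i).trans extremePoints_subset)
    (convex_simplotope _)

lemma prismForm_eq_sum (n : Fin 5 → ℤ) (x : PrismSpace) :
    prismForm n x = ∑ l, n l * prismForm (Pi.single l 1) x := by
  simp [prismForm, Fin.sum_univ_succ, Pi.single_apply]
  ring

lemma prismForm_single_zero {x : PrismSpace} (hx : x ∈ simplotope ![1, 1, 2]) :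
    prismForm (Pi.single 0 1) x = 1 := by
  rw [eq_ofReduced_of_mem_simplotope hx, prismForm_ofReduced]
  simp

lemma eq_of_prismForm_eq {x y : PrismSpace} (hx : x ∈ simplotope ![1, 1, 2])
    (hy : y ∈ simplotope ![1, 1, 2])
    (h : ∀ m, prismForm (Pi.single m 1) x = prismForm (Pi.single m 1) y) : x = y := by
  rw [eq_ofReduced_of_mem_simplotope hx, eq_ofReduced_of_mem_simplotope hy]
  have h1 := h 1
  have h2 := h 2
  have h3 := h 3
  have h4 := h 4
  simp [prismForm] at h1 h2 h3 h4
  rw [h1, h2, h3, h4]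

/-- The facet values divided by the volume are the barycentric coordinates of `x`. -/
lemma mem_convexHull_tenSimplex {x : PrismSpace} (hx : x ∈ simplotope ![1, 1, 2]) (i : Fin 10)
    (h : ∀ k, 0 ≤ prismForm (tenFacet i k) x) :
    x ∈ convexHull ℝ (tenSimplex i : Set PrismSpace) := by
  have hD := tenVolume_pos i
  let w (k : Fin 5) : ℝ := prismForm (tenFacet i k) x / tenVolume i
  have key : ∀ m, ∑ k, w k * vertexRow (tenVertex i k) m = prismForm (Pi.single m 1) x := by
    intro m
    have hs (l : Fin 5) : ∑ k, (tenFacet i k l : ℝ) * vertexRow (tenVertex i k) m =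
        if l = m then (tenVolume i : ℝ) else 0 := by
      exact_mod_cast sum_tenFacet_mul_vertexRow i l m
    calc ∑ k, w k * vertexRow (tenVertex i k) m
        = ∑ k, ∑ l, (tenFacet i k l * vertexRow (tenVertex i k) m) *
            (prismForm (Pi.single l 1) x / tenVolume i) := by
          refine Finset.sum_congr rfl fun k _ => ?_
          simp only [w]
          rw [prismForm_eq_sum, Finset.sum_div, Finset.sum_mul]
          exact Finset.sum_congr rfl fun l _ => by ring
      _ = ∑ l, (∑ k, (tenFacet i k l : ℝ) * vertexRow (tenVertex i k) m) *
            (prismForm (Pi.single l 1) x / tenVolume i) := by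
          rw [Finset.sum_comm]
          simp only [Finset.sum_mul]
      _ = prismForm (Pi.single m 1) x := by
          simp only [hs, ite_mul, zero_mul, Finset.sum_ite_eq', Finset.mem_univ, if_true]
          exact mul_div_cancel₀ _ hD.ne'
  have hv (v : Fin 12) (m : Fin 5) :
      prismForm (Pi.single m 1) (prismVertex v) = vertexRow v m := by
    rw [prismForm_prismVertex]
    exact_mod_cast (by revert v m; decide +kernel :
      ∀ v m, intForm (Pi.single m 1) (vertexRow v) = vertexRow v m) v m
  have hsum : ∑ k, w k = 1 := by
    have hrow : ∀ v, vertexRow v 0 = 1 := by decide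
    simpa [hrow, prismForm_single_zero hx] using key 0
  have hy : ∑ k, w k • prismVertex (tenVertex i k) ∈
      convexHull ℝ (tenSimplex i : Set PrismSpace) := by
    refine (convex_convexHull ℝ _).sum_mem (fun k _ => div_nonneg (h k) hD.le) hsum
      fun k _ => subset_convexHull ℝ _ ?_
    rw [coe_tenSimplex]
    exact ⟨k, rfl⟩
  convert hy using 1
  refine eq_of_prismForm_eq hx (convexHull_tenSimplex_subset i hy) fun m => ?_
  simp only [map_sum, map_smul, hv, smul_eq_mul, key]

lemma exists_forall_tenFacet_nonneg {x : PrismSpace} (hx : x ∈ simplotope ![1, 1, 2]) :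
    ∃ i, ∀ k, 0 ≤ prismForm (tenFacet i k) x := by
  obtain ⟨a, b, p, q, rfl⟩ : ∃ a b p q, x = ofReduced a b p q :=
    ⟨_, _, _, _, eq_ofReduced_of_mem_simplotope hx⟩
  obtain ⟨⟨ha, ha'⟩, ⟨hb, hb'⟩, hp, hq, hpq⟩ := ofReduced_mem_simplotope.1 hx
  simp only [prismForm_ofReduced, Fin.forall_fin_succ]
  -- The prism splits into `a - b ≥ q`, `|a - b| ≤ q` and `b - a ≥ q`; exchanging `a` and `b` swaps
  -- the outer two regions and their simplices.
  rcases le_total 0 (a - b - q) with h1 | h1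
  · rcases le_total p b with h2 | h2
    · exact ⟨7, by simp [tenFacet]; refine ⟨?_, ?_, ?_, ?_, ?_⟩ <;> linarith⟩
    rcases le_total (p + q) a with h3 | h3
    · exact ⟨6, by simp [tenFacet]; refine ⟨?_, ?_, ?_, ?_, ?_⟩ <;> linarith⟩
    · exact ⟨5, by simp [tenFacet]; refine ⟨?_, ?_, ?_, ?_, ?_⟩ <;> linarith⟩
  rcases le_total 0 (a - b + q) with h2 | h2
  · rcases le_total (2 * p + q) (a + b) with h3 | h3
    · rcases le_total (a + b + q) 2 with h4 | h4
      · exact ⟨0, by simp [tenFacet]; refine ⟨?_, ?_, ?_, ?_, ?_⟩ <;> linarith⟩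
      · exact ⟨8, by simp [tenFacet]; refine ⟨?_, ?_, ?_, ?_, ?_⟩ <;> linarith⟩
    rcases le_total q (a + b) with h4 | h4
    · exact ⟨4, by simp [tenFacet]; refine ⟨?_, ?_, ?_, ?_, ?_⟩ <;> linarith⟩
    · exact ⟨9, by simp [tenFacet]; refine ⟨?_, ?_, ?_, ?_, ?_⟩ <;> linarith⟩
  rcases le_total (p + q) b with h3 | h3
  · rcases le_total p a with h4 | h4
    · exact ⟨1, by simp [tenFacet]; refine ⟨?_, ?_, ?_, ?_, ?_⟩ <;> linarith⟩
    · exact ⟨2, by simp [tenFacet]; refine ⟨?_, ?_, ?_, ?_, ?_⟩ <;> linarith⟩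
  · exact ⟨3, by simp [tenFacet]; refine ⟨?_, ?_, ?_, ?_, ?_⟩ <;> linarith⟩

lemma iUnion_convexHull_tenSimplices :
    ⋃ s ∈ tenSimplices, convexHull ℝ (s : Set PrismSpace) = simplotope ![1, 1, 2] := by
  rw [tenSimplices_eq]
  refine Set.Subset.antisymm (Set.iUnion₂_subset fun s hs => ?_) fun x hx => ?_
  · obtain ⟨i, -, rfl⟩ := Finset.mem_image.1 hs
    exact convexHull_tenSimplex_subset i
  · obtain ⟨i, hi⟩ := exists_forall_tenFacet_nonneg hx
    exact Set.mem_iUnion₂.2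
      ⟨_, Finset.mem_image_of_mem _ (Finset.mem_univ i), mem_convexHull_tenSimplex hx i hi⟩

lemma isSimplicialCover_tenSimplices :
    IsSimplicialCover (simplotope ![1, 1, 2]) tenSimplices := by
  refine ⟨fun s hs => ?_, iUnion_convexHull_tenSimplices⟩
  rw [tenSimplices_eq] at hs
  obtain ⟨i, -, rfl⟩ := Finset.mem_image.1 hs
  rw [affineDim_simplotope]
  exact ⟨isSimplexVertexSet_tenSimplex i, tenSimplex_subset_extremePoints i⟩

/-! ### Face-to-face gluing of simplices -/

section Gluing

variable {E : Type*} [AddCommGroup E] [Module ℝ E]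

/-- Two polytopes on opposite sides of a hyperplane meet only in the hull of their common vertices
if all vertices of the first one on the hyperplane are vertices of the second one. -/
lemma convexHull_inter_subset_of_separated {A B : Finset E} (f : E →ₗ[ℝ] ℝ)
    (hA : ∀ v ∈ A, 0 ≤ f v) (hB : ∀ v ∈ B, f v ≤ 0) (hAB : ∀ v ∈ A, f v = 0 → v ∈ B) :
    convexHull ℝ (A : Set E) ∩ convexHull ℝ B ⊆ convexHull ℝ (A ∩ B : Set E) := by
  classical
  rintro x ⟨hxA, hxB⟩
  have hfx : f x ≤ 0 := convexHull_min hB (convex_halfSpace_le f.isLinear 0) hxB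
  obtain ⟨w, hw, hw1, rfl⟩ := Finset.mem_convexHull'.1 hxA
  have hterm : ∀ v ∈ A, 0 ≤ w v * f v := fun v hv => mul_nonneg (hw v hv) (hA v hv)
  -- The sum is `f x`, which is nonpositive from the side of `B`, while its terms are nonnegative.
  -- So only vertices of `A` on the hyperplane carry weight.
  have hsum : ∑ v ∈ A, w v * f v = 0 := by
    refine le_antisymm ?_ (Finset.sum_nonneg hterm)
    simpa only [map_sum, map_smul, smul_eq_mul] using hfx
  have hzero : ∀ v ∈ A, v ∉ A ∩ B → w v = 0 := fun v hv hvAB =>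
    (mul_eq_zero.1 ((Finset.sum_eq_zero_iff_of_nonneg hterm).1 hsum v hv)).resolve_right
      fun h => hvAB (Finset.mem_inter.2 ⟨hv, hAB v hv h⟩)
  rw [← Finset.coe_inter, Finset.mem_convexHull']
  refine ⟨w, fun v hv => hw v (Finset.mem_inter.1 hv).1, ?_, ?_⟩
  · rw [← hw1]
    exact Finset.sum_subset Finset.inter_subset_left hzero
  · refine Finset.sum_subset Finset.inter_subset_left fun v hv hv' => ?_
    rw [hzero v hv hv', zero_smul]

/-- Faces of simplices that meet in the hull of their common vertices do so as well. -/
lemma convexHull_inter_subset_of_faces {A B s t : Finset E}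
    (hA : AffineIndependent ℝ ((↑) : A → E)) (hB : AffineIndependent ℝ ((↑) : B → E))
    (hAB : convexHull ℝ (A : Set E) ∩ convexHull ℝ B ⊆ convexHull ℝ (A ∩ B : Set E))
    (hs : s ⊆ A) (ht : t ⊆ B) :
    convexHull ℝ (s : Set E) ∩ convexHull ℝ t ⊆ convexHull ℝ (s ∩ t : Set E) := by
  classical
  rintro x ⟨hxs, hxt⟩
  have hx := hAB ⟨convexHull_mono (by exact_mod_cast hs) hxs,
    convexHull_mono (by exact_mod_cast ht) hxt⟩
  rw [← Finset.coe_inter] at hx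
  -- Faces of one simplex intersect in their common face. This is used in `A` for `s` and `A ∩ B`,
  -- then in `B` for `s ∩ B` and `t`.
  have hxsB : x ∈ convexHull ℝ ((s ∩ B : Finset E) : Set E) := by
    have := (hA.convexHull_inter hs Finset.inter_subset_left).symm.subset ⟨hxs, hx⟩
    refine convexHull_mono ?_ this
    intro v hv
    simp only [Set.mem_inter_iff, Finset.mem_coe, Finset.mem_inter] at hv ⊢
    exact ⟨hv.1, hv.2.2⟩
  have := (hB.convexHull_inter Finset.inter_subset_right ht).symm.subset ⟨hxsB, hxt⟩
  refine convexHull_mono ?_ this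
  intro v hv
  simp only [Set.mem_inter_iff, Finset.mem_coe, Finset.mem_inter] at hv ⊢
  exact ⟨hv.1.1, hv.2⟩

/-- A collection of simplices of full dimension that covers `P` and meets face-to-face is a
triangulation of `P`. -/
lemma isTriangulation_of_pairwise {P : Set E} {C : Finset (Finset E)}
    (hC : ∀ s ∈ C, IsSimplexVertexSet (affineDim P) s)
    (hU : ⋃ s ∈ C, convexHull ℝ (s : Set E) = P)
    (hinter : ∀ A ∈ C, ∀ B ∈ C, A ≠ B →
      convexHull ℝ (A : Set E) ∩ convexHull ℝ B ⊆ convexHull ℝ (A ∩ B : Set E)) :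
    IsTriangulation P C := by
  have hne : ∀ s ∈ C, s.Nonempty := fun s hs => Finset.card_pos.1 (by rw [(hC s hs).2]; omega)
  let K : Geometry.SimplicialComplex ℝ E :=
    { faces := {s | s.Nonempty ∧ ∃ A ∈ C, s ⊆ A}
      isRelLowerSet_faces := by
        rintro s ⟨hs, A, hA, hsA⟩
        exact ⟨hs, fun t hts ht => ⟨ht, A, hA, subset_trans hts hsA⟩⟩
      indep := by
        rintro s ⟨-, A, hA, hsA⟩
        exact (hC A hA).1.mono (by exact_mod_cast hsA)
      inter_subset_convexHull := by
        rintro s t ⟨-, A, hA, hsA⟩ ⟨-, B, hB, htB⟩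
        refine convexHull_inter_subset_of_faces (hC A hA).1 (hC B hB).1 ?_ hsA htB
        by_cases h : A = B
        · subst h
          simp
        · exact hinter A hA B hB h }
  have hK : ∀ s, s ∈ K.faces ↔ s.Nonempty ∧ ∃ A ∈ C, s ⊆ A := fun _ => Iff.rfl
  refine ⟨hC, K, ?_, ?_⟩
  · ext s
    rw [Geometry.SimplicialComplex.mem_facets, hK]
    constructor
    · rintro ⟨⟨hs, A, hA, hsA⟩, hmax⟩
      rw [hmax A ((hK A).2 ⟨hne A hA, A, hA, subset_rfl⟩) hsA]
      exact hA
    · intro hs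
      refine ⟨⟨hne s hs, s, hs, subset_rfl⟩, ?_⟩
      rintro t ⟨-, A, hA, htA⟩ hst
      -- All members of `C` have the same cardinality, so none lies strictly inside another.
      refine Finset.eq_of_subset_of_card_le hst ?_
      rw [(hC s hs).2, ← (hC A hA).2]
      exact Finset.card_le_card htA
  · rw [← hU]
    ext x
    rw [Geometry.SimplicialComplex.mem_space_iff, Set.mem_iUnion₂]
    constructor
    · rintro ⟨s, ⟨-, A, hA, hsA⟩, hx⟩
      exact ⟨A, hA, convexHull_mono (by exact_mod_cast hsA) hx⟩
    · rintro ⟨A, hA, hx⟩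
      exact ⟨A, ⟨hne A hA, A, hA, subset_rfl⟩, hx⟩

end Gluing

/-! ### Pairwise separation of the ten simplices -/

/-- Forms that separate the ten simplices pairwise. -/
def separatingForms : List (Fin 5 → ℤ) :=
  [![2, -1, -1, 0, -1], ![0, -1, 1, 0, 1], ![0, 1, 1, 0, -1], ![0, 0, 1, -1, 0],
    ![0, -1, 0, 1, 1], ![0, -1, -1, 2, 1], ![0, -1, 1, 0, -1], ![0, 0, 1, -1, -1],
    ![0, 1, 0, -1, 0]]

/-- The form `n` is nonnegative on the `i`-th simplex and nonpositive on the `j`-th one, and the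
vertices of the former where it vanishes are vertices of the latter. -/
def Separates (n : Fin 5 → ℤ) (i j : Fin 10) : Prop :=
  ∀ k, 0 ≤ intForm n (vertexRow (tenVertex i k)) ∧
    intForm n (vertexRow (tenVertex j k)) ≤ 0 ∧
      (intForm n (vertexRow (tenVertex i k)) = 0 → ∃ l, tenVertex j l = tenVertex i k)

instance (n : Fin 5 → ℤ) (i j : Fin 10) : Decidable (Separates n i j) :=
  inferInstanceAs (Decidable (∀ _, _))

/-- The forms are, up to sign, the nine splits of the decision tree. Allowing both orders of the
pair is needed since each form is listed with one sign and the vertex condition concerns only the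
nonnegative side. -/
lemma exists_separates :
    ∀ i j, i ≠ j → ∃ n ∈ separatingForms, Separates n i j ∨ Separates n j i := by
  decide +kernel

lemma Separates.convexHull_inter_subset {n : Fin 5 → ℤ} {i j : Fin 10} (h : Separates n i j) :
    convexHull ℝ (tenSimplex i : Set PrismSpace) ∩ convexHull ℝ (tenSimplex j) ⊆
      convexHull ℝ (tenSimplex i ∩ tenSimplex j : Set PrismSpace) := by
  have hmem (i : Fin 10) (x : PrismSpace) :
      x ∈ tenSimplex i ↔ ∃ k, prismVertex (tenVertex i k) = x := by
    simp [tenSimplex]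
  refine convexHull_inter_subset_of_separated (prismForm n) ?_ ?_ ?_
  · intro v hv
    obtain ⟨k, rfl⟩ := (hmem i v).1 hv
    rw [prismForm_prismVertex]
    exact_mod_cast (h k).1
  · intro v hv
    obtain ⟨k, rfl⟩ := (hmem j v).1 hv
    rw [prismForm_prismVertex]
    exact_mod_cast (h k).2.1
  · intro v hv h0
    obtain ⟨k, rfl⟩ := (hmem i v).1 hv
    rw [prismForm_prismVertex] at h0
    obtain ⟨l, hl⟩ := (h k).2.2 (by exact_mod_cast h0)
    exact (hmem j _).2 ⟨l, by rw [hl]⟩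

lemma isTriangulation_tenSimplices :
    IsTriangulation (simplotope ![1, 1, 2]) tenSimplices := by
  refine isTriangulation_of_pairwise (fun s hs => (isSimplicialCover_tenSimplices.1 s hs).1)
    iUnion_convexHull_tenSimplices ?_
  rw [tenSimplices_eq]
  intro A hA B hB hAB
  obtain ⟨i, -, rfl⟩ := Finset.mem_image.1 hA
  obtain ⟨j, -, rfl⟩ := Finset.mem_image.1 hB
  obtain ⟨n, -, h | h⟩ := exists_separates i j fun h => hAB (by rw [h])
  · exact h.convexHull_inter_subset
  · rw [Set.inter_comm, Set.inter_comm (tenSimplex i : Set PrismSpace)]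
    exact h.convexHull_inter_subset

end

theorem mainTheorem2 :
    IsLeast {n : ℕ | ∃ C : Finset (Finset (∀ i : Fin 3, Fin ((![1, 1, 2] : Fin 3 → ℕ) i + 1) → ℝ)),
        IsSimplicialCover (simplotope ![1, 1, 2]) C ∧ C.card = n} 10 ∧
      tenSimplices.card = 10 ∧
      IsSimplicialCover (simplotope ![1, 1, 2]) tenSimplices ∧
      IsTriangulation (simplotope ![1, 1, 2]) tenSimplices := by
  refine ⟨⟨⟨tenSimplices, isSimplicialCover_tenSimplices, card_tenSimplices⟩, ?_⟩,
    card_tenSimplices, isSimplicialCover_tenSimplices, isTriangulation_tenSimplices⟩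
  rintro _ ⟨C, hC, rfl⟩
  exact ten_le_card_of_isSimplicialCover hC
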